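/- Let $n\ge 5$ be an integer and let $\lambda$ be an element of order $6$ in the group $\mathbb{Z}_n^{*}$ of units mod $n$ such that $1+\lambda^2+\lambda^4\equiv 0 \pmod n$. Let $D_n=\langle a,b \mid a^n=b^2=(ab)^2=1\rangle$ be the dihedral group of order $2n$, and put $$S=\{a^{c_i} : i=0,1,2\}\cup\{ba^{d_i} : i=0,1,2\},\qquad c_i=\sum_{j=0}^{i}\lambda^{2j},\quad d_i=\lambda c_i .$$ Let $\Gamma(n,\lambda,6)$ be the bi-Cayley graph $\mathrm{BiCay}(D_n,\emptyset,\emptyset,S)$: its vertices are $h_0$ and $h_1$ for $h\in D_n$ (two disjoint copies of $D_n$), and its edges are the pairs $\{h_0,(zh)_1\}$ with $h\in D_n$ and $z\in S$. For $g\in D_n$ let $R(g)$ be the automorphism $h_i\mapsto (hg)_i$ of this graph, and let $R(D_n)=\{R(g): g\in D_n\}$, a subgroup isomorphic to $D_n$. A graph is called semisymmetric if all its vertices have the same valency and its automorphism group is transitive on edges but not on vertices; it is called edge-regular if its automorphism group acts regularly on its edges, that is, transitively and with trivial edge-stabilisers. Then $\Gamma(n,\lambda,6)$ is semisymmetric.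 If moreover $\lambda^3\not\equiv-1 \pmod n$, then $\Gamma(n,\lambda,6)$ is edge-regular, the stabiliser in $\mathrm{Aut}(\Gamma(n,\lambda,6))$ of every vertex is cyclic of order $6$, the subgroup $R(D_n)$ is normal in $\mathrm{Aut}(\Gamma(n,\lambda,6))$, and every vertex-stabiliser is a complement of it; so $\mathrm{Aut}(\Gamma(n,\lambda,6))=R(D_n)\rtimes C_6$. -/

import Mathlib

/-- The full automorphism group of `G` (that is, `G ≃g G`, a group under composition) acts
transitively on the vertices. -/
def IsVertexTransitive {V : Type*} (G : SimpleGraph V) : Prop :=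
  ∀ u v : V, ∃ g : G ≃g G, g u = v

/-- The full automorphism group of `G` acts transitively on the (undirected) edges. -/
def IsEdgeTransitive {V : Type*} (G : SimpleGraph V) : Prop :=
  ∀ e ∈ G.edgeSet, ∀ f ∈ G.edgeSet, ∃ g : G ≃g G, Sym2.map g e = f

/-- The full automorphism group of `G` acts regularly on the (undirected) edges: transitively,
and with trivial edge-stabilisers. -/
def IsEdgeRegular {V : Type*} (G : SimpleGraph V) : Prop :=
  IsEdgeTransitive G ∧ ∀ e ∈ G.edgeSet, ∀ g : G ≃g G, Sym2.map g e = e → g = 1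

/-- Constant (finite) valency, edge-transitive but not vertex-transitive. -/
def IsSemisymmetric {V : Type*} (G : SimpleGraph V) : Prop :=
  (∃ d : ℕ, ∀ v : V, (G.neighborSet v).encard = d) ∧
    IsEdgeTransitive G ∧ ¬ IsVertexTransitive G

/-- The relation whose symmetric closure is adjacency in a bi-Cayley graph. The vertex `h₀` is
`Sum.inl h` and the vertex `h₁` is `Sum.inr h`. -/
def biCayRel {H : Type*} [Group H] (R L S : Set H) : H ⊕ H → H ⊕ H → Prop
  | Sum.inl g, Sum.inl h => ∃ x ∈ R, h = x * g
  | Sum.inr g, Sum.inr h => ∃ y ∈ L, h = y * g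
  | Sum.inl g, Sum.inr h => ∃ z ∈ S, h = z * g
  | Sum.inr _, Sum.inl _ => False

/-- The bi-Cayley graph `BiCay(H, R, L, S)`, with edges `{h₀, (xh)₀}`, `{h₁, (yh)₁}` and
`{h₀, (zh)₁}` for `x ∈ R`, `y ∈ L`, `z ∈ S` and `h ∈ H` (loops, which could arise only
for `1 ∈ R ∪ L`, are discarded). -/
def biCay {H : Type*} [Group H] (R L S : Set H) : SimpleGraph (H ⊕ H) :=
  SimpleGraph.fromRel (biCayRel R L S)

theorem biCayRel_mul_right {H : Type*} [Group H] (R L S : Set H) (g : H) (u v : H ⊕ H) :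
    biCayRel R L S (Sum.map (· * g) (· * g) u) (Sum.map (· * g) (· * g) v) ↔
      biCayRel R L S u v := by
  rcases u with u | u <;> rcases v with v | v <;>
    simp [biCayRel, ← mul_assoc]

/-- `H` acting on `BiCay(H, R, L, S)` by right multiplication on both copies of `H`.
Automorphisms compose from right to left, so `g` is sent to `hᵢ ↦ (h g⁻¹)ᵢ` in order to get a
homomorphism; its range is the group `R(H)` of all maps `hᵢ ↦ (h g)ᵢ`. -/
def biCayRight {H : Type*} [Group H] (R L S : Set H) :
    H →* (biCay R L S ≃g biCay R L S) where
  toFun g :=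
    { toEquiv := Equiv.sumCongr (Equiv.mulRight g⁻¹) (Equiv.mulRight g⁻¹)
      map_rel_iff' := by
        intro u v
        have h := biCayRel_mul_right R L S g⁻¹
        have e : ∀ w : H ⊕ H, Equiv.sumCongr (Equiv.mulRight g⁻¹) (Equiv.mulRight g⁻¹) w =
            Sum.map (· * g⁻¹) (· * g⁻¹) w := by
          rintro (w | w) <;> rfl
        simp only [biCay, SimpleGraph.fromRel_adj, ne_eq, EmbeddingLike.apply_eq_iff_eq]
        rw [e u, e v, h u v, h v u] }
  map_one' := by
    ext v
    rcases v with v | v <;> simp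
  map_mul' g h := by
    ext v
    rcases v with v | v <;> simp [mul_assoc]

theorem biCayRight_injective {H : Type*} [Group H] (R L S : Set H) :
    Function.Injective (biCayRight R L S) := by
  intro g h e
  have e' : (biCayRight R L S g) (Sum.inl 1) = (biCayRight R L S h) (Sum.inl 1) := by rw [e]
  simpa [biCayRight] using e'

/-- `cᵢ = 1 + λ² + λ⁴ + ⋯ + λ²ⁱ` in `ℤ/nℤ`. -/
def cCoeff (n : ℕ) (lam : (ZMod n)ˣ) (i : ℕ) : ZMod n :=
  ∑ j ∈ Finset.range (i + 1), (lam : ZMod n) ^ (2 * j)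

/-- `dᵢ = λ cᵢ = λ + λ³ + λ⁵ + ⋯ + λ²ⁱ⁺¹` in `ℤ/nℤ`. -/
def dCoeff (n : ℕ) (lam : (ZMod n)ˣ) (i : ℕ) : ZMod n :=
  (lam : ZMod n) * cCoeff n lam i

/-- The set `S(n, λ, 2k) = {a^{cᵢ} : 0 ≤ i < k} ∪ {b a^{dᵢ} : 0 ≤ i < k}` in the dihedral group
of order `2n`, where `a = r 1` and `b = sr 0`, so that `a ^ i = r i` and `b * a ^ i = sr i`. -/
def gammaSet (n k : ℕ) (lam : (ZMod n)ˣ) : Set (DihedralGroup n) :=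
  {x | ∃ i < k, x = DihedralGroup.r (cCoeff n lam i)} ∪
    {x | ∃ i < k, x = DihedralGroup.sr (dCoeff n lam i)}

/-- The graph `Γ(n, λ, 2k) = BiCay(Dₙ, ∅, ∅, S(n, λ, 2k))`. -/
def gammaGraph (n k : ℕ) (lam : (ZMod n)ˣ) : SimpleGraph (DihedralGroup n ⊕ DihedralGroup n) :=
  biCay ∅ ∅ (gammaSet n k lam)

/-- The group `R(Dₙ)` of automorphisms of `Γ(n, λ, 2k)` induced by right multiplication. -/
def gammaRight (n k : ℕ) (lam : (ZMod n)ˣ) :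
    Subgroup (gammaGraph n k lam ≃g gammaGraph n k lam) :=
  (biCayRight ∅ ∅ (gammaSet n k lam)).range

/-!
Write `μ = λ²`, so that `1 + μ + μ² = 0`, and let `T = {0, 1, 1 + μ}` be the triangle of the
exponents `cᵢ`; the exponents `dᵢ` form `λT`. The vertices fall into four blocks, the rotations
and the reflections of `Dₙ` on either side, each a copy of `ℤ/n`. Rotations are joined to
rotations and reflections to reflections by differences in `±T`, and rotations to reflections by
differences in `±λT`. Each of these four pieces is a honeycomb on a torus.

*Edge-transitivity.* As `μT + 1 = T`, multiplication by `λ`, suitably translated on each block, is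
an automorphism `rot` that fixes `1₀` and permutes its six neighbours cyclically. With `R(Dₙ)`
it moves `{1₀, 1₁}` to every edge (`exists_transl_mul_rot_pow`) without exchanging the sides.

*The case `λ³ = -1`.* Then `λT` is a translate of `-T`, and `1₀` has the same neighbours as another
vertex. The vertex `1₁` has no such twin, since `T` is not a translate of `-T` and is not invariant
under any nonzero translation. Hence the graph is not vertex-transitive.

*The case `λ³ ≠ -1`.* The differences of distinct points of `T` have cube `±1` while `λ³ ≠ ±1`,
so two neighbours of a vertex have no second common neighbour if both are rotations or both are
reflections, and they always have one otherwise. An automorphism therefore respects the distinction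
between differences in `±T` and in `±λT` or interchanges the two, and it respects it if it maps
some edge between rotations to such an edge (`isReflection_apply_iff`); it then maps honeycombs to
honeycombs. In a honeycomb a path of length three lies on a hexagon exactly if its labels are
distinct; this can fail only if `2`, `3` or `7` is zero in `ℤ/n`, and `n = 7` forces `λ³ = ±1`. Consequently a map between honeycombs permutes labels in the
same way everywhere, and as `ℤ/n` is cyclic it is affine, with multiplier `1`, `μ` or `μ²` once the
two honeycombs are scaled to `T` (`triangle.rigid`). An automorphism fixing the edge `1₀1₁`
pointwise is thus the identity, first on the rotations and then on the other two blocks. One that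
reverses the edge would act on the rotations of `1₀`'s side with a multiplier in `-{1, μ, μ²}`, by
the first honeycomb, and in `{1, μ, μ²}`, by the second, but `-1` is not a power of `μ`. So
no automorphism exchanges the sides and all automorphisms lie in `R(Dₙ)⟨rot⟩`, from which the
group-theoretic claims follow.
-/

/-! ### The triangle `T` -/

/-- The triangle `{0, 1, 1 + μ}`. For a primitive cube root of unity `μ` its sides, read
cyclically, are `1`, `μ`, `μ²`. -/
def triangle {R : Type*} [CommRing R] (μ : R) : Set R := {0, 1, 1 + μ}

namespace triangle

section CommRing

variable {R : Type*} [CommRing R] {μ : R}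

theorem zero_mem (μ : R) : 0 ∈ triangle μ := by simp [triangle]

theorem one_mem (μ : R) : 1 ∈ triangle μ := by simp [triangle]

theorem one_add_mem (μ : R) : 1 + μ ∈ triangle μ := by simp [triangle]

theorem mem_iff {x : R} : x ∈ triangle μ ↔ x = 0 ∨ x = 1 ∨ x = 1 + μ := by simp [triangle]

theorem ne_zero_and_ne_zero (h2 : (2 : R) ≠ 0) (hμ : 1 + μ + μ ^ 2 = 0) :
    (1 : R) ≠ 0 ∧ μ ≠ 0 ∧ 1 + μ ≠ 0 := by
  refine ⟨?_, ?_, ?_⟩ <;> intro h <;> grind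

/-- The affine map `x ↦ μ x + 1` rotates the triangle. -/
theorem mul_add_one_mem_iff (hμ : 1 + μ + μ ^ 2 = 0) {x : R} :
    μ * x + 1 ∈ triangle μ ↔ x ∈ triangle μ := by
  have hμ3 : μ * μ ^ 2 = 1 := by grind
  simp only [mem_iff]
  constructor
  · rintro (h | h | h)
    · right; right; grind
    · left; grind
    · right; left; grind
  · rintro (rfl | rfl | rfl) <;> grind

theorem eq_zero_of_add_mem (h2 : (2 : R) ≠ 0) (hμ : 1 + μ + μ ^ 2 = 0)
    (hμ1 : μ ≠ 1) {j : R} (h : ∀ t ∈ triangle μ, j + t ∈ triangle μ) : j = 0 := by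
  have a := h _ (zero_mem μ)
  have b := h _ (one_mem μ)
  have c := h _ (one_add_mem μ)
  obtain ⟨h10, h0, h01⟩ := ne_zero_and_ne_zero h2 hμ
  rw [mem_iff] at a b c
  rcases a with a | a | a <;> rcases b with b | b | b <;> rcases c with c | c | c <;> grind

/-- The triangle is not a translate of its negative: its sides have the opposite orientation. -/
theorem not_sub_mem (h2 : (2 : R) ≠ 0) (hμ : 1 + μ + μ ^ 2 = 0)
    (hμ1 : μ ≠ 1) (j : R) : ¬ ∀ t ∈ triangle μ, j - t ∈ triangle μ := by
  intro h
  have a := h _ (zero_mem μ)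
  have b := h _ (one_mem μ)
  have c := h _ (one_add_mem μ)
  obtain ⟨h10, h0, h01⟩ := ne_zero_and_ne_zero h2 hμ
  rw [mem_iff] at a b c
  rcases a with a | a | a <;> rcases b with b | b | b <;> rcases c with c | c | c <;> grind

/-- The differences of distinct points are `±1`, `±μ`, `±μ²`. -/
theorem sub_cube (hμ : 1 + μ + μ ^ 2 = 0) {s t : R} (hs : s ∈ triangle μ)
    (ht : t ∈ triangle μ) (hst : s ≠ t) : (s - t) ^ 3 = 1 ∨ (s - t) ^ 3 = -1 := by
  rw [mem_iff] at hs ht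
  rcases hs with rfl | rfl | rfl <;> rcases ht with rfl | rfl | rfl <;> grind

theorem eq_of_sub_eq_sub (h2 : (2 : R) ≠ 0) (hμ : 1 + μ + μ ^ 2 = 0)
    (hμ1 : μ ≠ 1) {s t s' t' : R} (hs : s ∈ triangle μ) (ht : t ∈ triangle μ)
    (hs' : s' ∈ triangle μ) (ht' : t' ∈ triangle μ) (hst : s ≠ t)
    (h : s - t = s' - t') : s = s' := by
  obtain ⟨h10, h0, h01⟩ := ne_zero_and_ne_zero h2 hμ
  rw [mem_iff] at hs ht hs' ht'
  rcases hs with rfl | rfl | rfl <;> rcases ht with rfl | rfl | rfl <;>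
    first
    | exact absurd rfl hst
    | (rcases hs' with rfl | rfl | rfl <;> rcases ht' with rfl | rfl | rfl <;> grind)

/-- The triangle has no fourth point. -/
theorem eq_of_ne (μ : R) {q a b c : R} (hq : q ∈ triangle μ)
    (ha : a ∈ triangle μ) (hb : b ∈ triangle μ) (hc : c ∈ triangle μ) (hab : a ≠ b)
    (hac : a ≠ c) (hbc : b ≠ c) (hqa : q ≠ a) (hqb : q ≠ b) : q = c := by
  rw [mem_iff] at hq ha hb hc
  grind

/-- A path of length three with labels `b, a, b` does not lie on a hexagon: `α, β, γ` are the labels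
of the path that would complete it. Each choice of labels amounts to `x + y * μ = 0` for some
integers `x` and `y`, hence to the vanishing of the norm `x² - x y + y²`, which is `4`, `7`
or `9`. -/
theorem no_hexagon (h2 : (2 : R) ≠ 0) (h3 : (3 : R) ≠ 0) (h7 : (7 : R) ≠ 0)
    (hμ : 1 + μ + μ ^ 2 = 0) {a b α β γ : R} (ha : a ∈ triangle μ) (hb : b ∈ triangle μ)
    (hα : α ∈ triangle μ) (hβ : β ∈ triangle μ) (hγ : γ ∈ triangle μ)
    (hab : a ≠ b) (hαb : α ≠ b) (hγb : γ ≠ b) (hβα : β ≠ α) (hβγ : β ≠ γ) :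
    a + α + γ ≠ 2 * b + β := by
  intro h
  obtain ⟨h10, h0, h01⟩ := ne_zero_and_ne_zero h2 hμ
  rw [mem_iff] at ha hb hα hβ hγ
  rcases hb with rfl | rfl | rfl <;> rcases ha with rfl | rfl | rfl <;>
    first
    | exact absurd rfl hab
    | (rcases hα with rfl | rfl | rfl <;>
        first
        | exact absurd rfl hαb
        | (rcases hγ with rfl | rfl | rfl <;>
            first
            | exact absurd rfl hγb
            | (rcases hβ with rfl | rfl | rfl <;>
                first
                | exact absurd rfl hβα
                | exact absurd rfl hβγ
                | grind)))

end CommRing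

/-! ### Rigidity of the honeycomb

The honeycomb has two copies of `ℤ/n` as its vertices, with `x` in the first joined to `y` in the
second if `y - x` lies in the triangle; this difference is the label of the edge. -/

/-- If `t, t', t''` are the three labels, the path `x + t - t''`, `x + t`, `x`, `x + t'` lies on a
hexagon, and so does its image, whose two outer labels therefore differ. -/
theorem label_ne {n : ℕ} {μ : ZMod n} (h2 : (2 : ZMod n) ≠ 0) (h3 : (3 : ZMod n) ≠ 0)
    (h7 : (7 : ZMod n) ≠ 0) (hμ : 1 + μ + μ ^ 2 = 0) {f₀ f₁ : ZMod n → ZMod n}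
    (hf₀ : Function.Injective f₀) (hf₁ : Function.Injective f₁)
    (h : ∀ x y, y - x ∈ triangle μ → f₁ y - f₀ x ∈ triangle μ) {t t' t'' : ZMod n}
    (ht : t ∈ triangle μ) (ht' : t' ∈ triangle μ) (ht'' : t'' ∈ triangle μ)
    (h₁ : t ≠ t') (h₂ : t ≠ t'') (h₃ : t' ≠ t'') (x : ZMod n) :
    f₁ (x + t) - f₀ (x + t - t'') ≠ f₁ (x + t') - f₀ x := by
  intro hb
  refine no_hexagon (a := f₁ (x + t) - f₀ x) (b := f₁ (x + t') - f₀ x)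
    (α := f₁ (x + t + t' - t'') - f₀ (x + t - t''))
    (β := f₁ (x + t + t' - t'') - f₀ (x + t' - t''))
    (γ := f₁ (x + t') - f₀ (x + t' - t'')) h2 h3 h7 hμ
    (h _ _ (by convert ht using 1; ring)) (h _ _ (by convert ht' using 1; ring))
    (h _ _ (by convert ht' using 1; ring)) (h _ _ (by convert ht using 1; ring))
    (h _ _ (by convert ht'' using 1; ring)) ?_ ?_ ?_ ?_ ?_ ?_
  · intro e; have := hf₁ (sub_left_injective e); grind
  · intro e
    rw [← hb] at e
    have := hf₁ (sub_left_injective e); grind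
  · intro e; have := hf₀ (sub_right_injective e); grind
  · intro e; have := hf₀ (sub_right_injective e); grind
  · intro e; have := hf₁ (sub_left_injective e); grind
  · linear_combination hb

/-- The two ends of the edge `x`, `x + t` agree on the label given to the image of an edge of
label `t''`. -/
theorem label_eq {n : ℕ} {μ : ZMod n} (h2 : (2 : ZMod n) ≠ 0) (h3 : (3 : ZMod n) ≠ 0)
    (h7 : (7 : ZMod n) ≠ 0) (hμ : 1 + μ + μ ^ 2 = 0) {f₀ f₁ : ZMod n → ZMod n}
    (hf₀ : Function.Injective f₀) (hf₁ : Function.Injective f₁)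
    (h : ∀ x y, y - x ∈ triangle μ → f₁ y - f₀ x ∈ triangle μ) {t t' t'' : ZMod n}
    (ht : t ∈ triangle μ) (ht' : t' ∈ triangle μ) (ht'' : t'' ∈ triangle μ)
    (h₁ : t ≠ t') (h₂ : t ≠ t'') (h₃ : t' ≠ t'') (x : ZMod n) :
    f₁ (x + t) - f₀ (x + t - t'') = f₁ (x + t'') - f₀ x := by
  refine eq_of_ne μ (a := f₁ (x + t) - f₀ x) (b := f₁ (x + t') - f₀ x)
    (h _ _ (by convert ht'' using 1; ring)) (h _ _ (by convert ht using 1; ring))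
    (h _ _ (by convert ht' using 1; ring)) (h _ _ (by convert ht'' using 1; ring)) ?_ ?_ ?_ ?_
    (label_ne h2 h3 h7 hμ hf₀ hf₁ h ht ht' ht'' h₁ h₂ h₃ x)
  · intro e; have := hf₁ (sub_left_injective e); grind
  · intro e; have := hf₁ (sub_left_injective e); grind
  · intro e; have := hf₁ (sub_left_injective e); grind
  · intro e; have := hf₀ (sub_right_injective e); grind

/-- A map between honeycombs is affine, and its multiplier is a power of `μ`. -/
theorem rigid {n : ℕ} [NeZero n] {μ : ZMod n} (h2 : (2 : ZMod n) ≠ 0) (h3 : (3 : ZMod n) ≠ 0)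
    (h7 : (7 : ZMod n) ≠ 0) (hμ : 1 + μ + μ ^ 2 = 0) (hμ1 : μ ≠ 1) {f₀ f₁ : ZMod n → ZMod n}
    (hf₀ : Function.Injective f₀) (hf₁ : Function.Injective f₁)
    (h : ∀ x y, y - x ∈ triangle μ → f₁ y - f₀ x ∈ triangle μ) :
    ∃ u e : ZMod n, (u = 1 ∧ e = 0 ∨ u = μ ∧ e = 1 ∨ u = μ ^ 2 ∧ e = 1 + μ) ∧
      (∀ x, f₀ x = u * x + f₀ 0) ∧ ∀ x, f₁ x = f₀ x + e := by
  obtain ⟨h10, h0, h01⟩ := ne_zero_and_ne_zero h2 hμ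
  have m0 := zero_mem μ
  have m1 := one_mem μ
  have m2 := one_add_mem μ
  have d1 : (0 : ZMod n) ≠ 1 + μ := h01.symm
  have d2 : (1 : ZMod n) ≠ 1 + μ := by grind
  -- The permutations of labels at `x` and at `x + 1` agree, as these two vertices have the
  -- neighbour `x + 1` of the second copy in common.
  have step : ∀ x, ∀ s ∈ triangle μ, f₁ (x + 1 + s) - f₀ (x + 1) = f₁ (x + s) - f₀ x := by
    have key : ∀ x, ∀ s ∈ triangle μ, ∀ t ∈ triangle μ,
        f₁ (x + t) - f₀ (x + t - s) = f₁ (x + s) - f₀ x := by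
      intro x s hs t ht
      by_cases hst : s = t
      · subst hst; simp
      obtain ⟨r, hr, hr1, hr2⟩ : ∃ r ∈ triangle μ, t ≠ r ∧ r ≠ s := by
        rw [mem_iff] at hs ht
        rcases hs with rfl | rfl | rfl <;> rcases ht with rfl | rfl | rfl <;>
          first
          | exact absurd rfl hst
          | exact ⟨_, m0, by grind, by grind⟩
          | exact ⟨_, m1, by grind, by grind⟩
          | exact ⟨_, m2, by grind, by grind⟩
      exact label_eq h2 h3 h7 hμ hf₀ hf₁ h ht hr hs hr1 (Ne.symm hst) hr2 x
    intro x s hs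
    have a := key x s hs 1 m1
    have b := key (x + 1) s hs 0 m0
    rw [add_zero] at b
    exact b.symm.trans a
  have const : ∀ x, ∀ s ∈ triangle μ, f₁ (x + s) - f₀ x = f₁ s - f₀ 0 := by
    intro x s hs
    rw [← ZMod.natCast_zmod_val x]
    induction x.val with
    | zero => simp
    | succ k ih => rw [Nat.cast_succ, step _ s hs, ih]
  have e0 : ∀ x, f₁ x = f₀ x + (f₁ 0 - f₀ 0) := fun x => by
    have := const x 0 m0
    rw [add_zero] at this
    linear_combination this
  have e1 : ∀ x, f₀ x = (f₁ 1 - f₁ 0) * x + f₀ 0 := by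
    intro x
    rw [← ZMod.natCast_zmod_val x]
    induction x.val with
    | zero => simp
    | succ k ih =>
      have a := const k 1 m1
      have b := e0 (k + 1)
      push_cast
      linear_combination ih + a - b
  refine ⟨f₁ 1 - f₁ 0, f₁ 0 - f₀ 0, ?_, e1, e0⟩
  have a0 := h 0 0 (by simpa using m0)
  have a1 := h 0 1 (by simpa using m1)
  have a2 := h 0 (1 + μ) (by simpa using m2)
  have b := e0 (1 + μ)
  have c := e1 (1 + μ)
  have i1 : f₁ 0 ≠ f₁ 1 := fun e => h10.symm (hf₁ e)
  have i2 : f₁ 0 ≠ f₁ (1 + μ) := fun e => d1 (hf₁ e)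
  have i3 : f₁ 1 ≠ f₁ (1 + μ) := fun e => d2 (hf₁ e)
  obtain ⟨p, hp⟩ : ∃ p, p = f₁ 0 - f₀ 0 := ⟨_, rfl⟩
  obtain ⟨q, hq⟩ : ∃ q, q = f₁ 1 - f₀ 0 := ⟨_, rfl⟩
  obtain ⟨r, hr⟩ : ∃ r, r = f₁ (1 + μ) - f₀ 0 := ⟨_, rfl⟩
  rw [← hp, mem_iff] at a0
  rw [← hq, mem_iff] at a1
  rw [← hr, mem_iff] at a2
  have hpq : p ≠ q := fun e => i1 (by grind)
  have hpr : p ≠ r := fun e => i2 (by grind)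
  have hqr : q ≠ r := fun e => i3 (by grind)
  have rel : r - p = (q - p) * (1 + μ) := by
    rw [hp, hq, hr]; linear_combination b + c
  have g1 : f₁ 1 - f₁ 0 = q - p := by rw [hp, hq]; ring
  rw [g1, ← hp]
  -- The multiplier is `q - p`; an odd permutation `(p, q, r)` of the triangle contradicts `rel`.
  clear const step e0 e1 h hf₀ hf₁ hp hq hr b c i1 i2 i3 g1
  rcases a0 with rfl | rfl | rfl <;> rcases a1 with rfl | rfl | rfl <;>
    first
    | exact absurd rfl hpq
    | (rcases a2 with rfl | rfl | rfl <;>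
        first
        | exact absurd rfl hpr
        | exact absurd rfl hqr
        | grind)

/-- The form of `triangle.rigid` for honeycombs whose triangles are scaled by the units `a⁻¹` and
`b⁻¹`. -/
theorem rigid_smul {n : ℕ} [NeZero n] {μ : ZMod n} (h2 : (2 : ZMod n) ≠ 0)
    (h3 : (3 : ZMod n) ≠ 0) (h7 : (7 : ZMod n) ≠ 0) (hμ : 1 + μ + μ ^ 2 = 0) (hμ1 : μ ≠ 1)
    {f₀ f₁ : ZMod n → ZMod n} (hf₀ : Function.Injective f₀) (hf₁ : Function.Injective f₁)
    (a b : (ZMod n)ˣ)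
    (h : ∀ x y, (a : ZMod n) * (y - x) ∈ triangle μ → (b : ZMod n) * (f₁ y - f₀ x) ∈ triangle μ) :
    ∃ u e : ZMod n, (u = 1 ∧ e = 0 ∨ u = μ ∧ e = 1 ∨ u = μ ^ 2 ∧ e = 1 + μ) ∧
      (∀ x, (b : ZMod n) * f₀ x = u * (a * x) + b * f₀ 0) ∧
      ∀ x, (b : ZMod n) * f₁ x = b * f₀ x + e := by
  have ha : ∀ x : ZMod n, (a : ZMod n) * ((a⁻¹ : (ZMod n)ˣ) * x) = x := fun x => by
    rw [← mul_assoc]; simp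
  have ha' : ∀ x : ZMod n, ((a⁻¹ : (ZMod n)ˣ) : ZMod n) * (a * x) = x := fun x => by
    rw [← mul_assoc]; simp
  have inj : ∀ f : ZMod n → ZMod n, Function.Injective f →
      Function.Injective fun x => (b : ZMod n) * f ((a⁻¹ : (ZMod n)ˣ) * x) := fun f hf x y e =>
    (Units.mul_right_inj _).1 (hf ((Units.mul_right_inj _).1 e))
  obtain ⟨u, e, hue, h₀, h₁⟩ := rigid (f₀ := fun x => (b : ZMod n) * f₀ ((a⁻¹ : (ZMod n)ˣ) * x))
    (f₁ := fun x => (b : ZMod n) * f₁ ((a⁻¹ : (ZMod n)ˣ) * x)) h2 h3 h7 hμ hμ1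
    (inj _ hf₀) (inj _ hf₁) (fun x y hxy => by
      have := h ((a⁻¹ : (ZMod n)ˣ) * x) ((a⁻¹ : (ZMod n)ˣ) * y) (by rwa [← mul_sub, ha])
      rwa [mul_sub] at this)
  refine ⟨u, e, hue, fun x => ?_, fun x => ?_⟩
  · simpa [ha'] using h₀ (a * x)
  · simpa [ha'] using h₁ (a * x)

/-- A map from a scaled honeycomb to itself that fixes the first copy of `ℤ/n` pointwise is the
identity. -/
theorem rigid_of_eq_id {n : ℕ} [NeZero n] {μ : ZMod n} (h2 : (2 : ZMod n) ≠ 0)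
    (h3 : (3 : ZMod n) ≠ 0) (h7 : (7 : ZMod n) ≠ 0) (hμ : 1 + μ + μ ^ 2 = 0) (hμ1 : μ ≠ 1)
    {f₀ f₁ : ZMod n → ZMod n} (hf₀ : ∀ x, f₀ x = x) (hf₁ : Function.Injective f₁) (a : (ZMod n)ˣ)
    (h : ∀ x y, (a : ZMod n) * (y - x) ∈ triangle μ → (a : ZMod n) * (f₁ y - f₀ x) ∈ triangle μ) :
    ∀ x, f₁ x = x := by
  obtain rfl : f₀ = id := funext hf₀
  obtain ⟨u, e, hue, h₀, h₁⟩ :=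
    rigid_smul h2 h3 h7 hμ hμ1 Function.injective_id hf₁ a a h
  have hu : u = 1 := by simpa using (h₀ (a⁻¹ : (ZMod n)ˣ)).symm
  have he : e = 0 := by
    subst hu
    rcases hue with h | h | h
    · exact h.2
    · exact absurd h.1.symm hμ1
    · exact absurd (by linear_combination μ * h.1 + (μ - 1) * hμ) hμ1
  intro x
  have := h₁ x
  rw [he, add_zero] at this
  exact (Units.mul_right_inj a).1 this

end triangle

/-! ### Adjacency in coordinates -/

namespace gammaGraph

open DihedralGroup

variable {n : ℕ} {lam : (ZMod n)ˣ}

theorem not_adj_inl_inl (x y : DihedralGroup n) :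
    ¬ (gammaGraph n 3 lam).Adj (Sum.inl x) (Sum.inl y) := by
  simp [gammaGraph, biCay, biCayRel]

theorem not_adj_inr_inr (x y : DihedralGroup n) :
    ¬ (gammaGraph n 3 lam).Adj (Sum.inr x) (Sum.inr y) := by
  simp [gammaGraph, biCay, biCayRel]

theorem adj_inr_inl (x y : DihedralGroup n) :
    (gammaGraph n 3 lam).Adj (Sum.inr x) (Sum.inl y) ↔
      (gammaGraph n 3 lam).Adj (Sum.inl y) (Sum.inr x) :=
  SimpleGraph.adj_comm ..

theorem adj_inl_inr (x y : DihedralGroup n) :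
    (gammaGraph n 3 lam).Adj (Sum.inl x) (Sum.inr y) ↔ y * x⁻¹ ∈ gammaSet n 3 lam := by
  simp only [gammaGraph, biCay, SimpleGraph.fromRel_adj, biCayRel, or_false]
  exact ⟨by rintro ⟨-, z, hz, rfl⟩; simpa using hz, fun h => ⟨Sum.inl_ne_inr, _, h, by simp⟩⟩

theorem r_mem (hμ : 1 + (lam : ZMod n) ^ 2 + ((lam : ZMod n) ^ 2) ^ 2 = 0) (x : ZMod n) :
    r x ∈ gammaSet n 3 lam ↔ x ∈ triangle ((lam : ZMod n) ^ 2) := by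
  have e0 : cCoeff n lam 0 = 1 := by simp [cCoeff]
  have e1 : cCoeff n lam 1 = 1 + (lam : ZMod n) ^ 2 := by simp [cCoeff, Finset.sum_range_succ]
  have e2 : cCoeff n lam 2 = 0 := by
    simp only [cCoeff, Finset.sum_range_succ, Finset.sum_range_zero]
    linear_combination hμ
  rw [triangle.mem_iff]
  constructor
  · rintro (⟨i, hi, h⟩ | ⟨i, hi, h⟩)
    · rw [r.injEq] at h
      interval_cases i <;> simp_all
    · simp at h
  · rintro (h | h | h)
    · exact .inl ⟨2, by norm_num, by rw [e2, h]⟩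
    · exact .inl ⟨0, by norm_num, by rw [e0, h]⟩
    · exact .inl ⟨1, by norm_num, by rw [e1, h]⟩

theorem sr_mem (hμ : 1 + (lam : ZMod n) ^ 2 + ((lam : ZMod n) ^ 2) ^ 2 = 0) (x : ZMod n) :
    sr x ∈ gammaSet n 3 lam ↔ (lam⁻¹ : (ZMod n)ˣ) * x ∈ triangle ((lam : ZMod n) ^ 2) := by
  rw [← r_mem hμ]
  constructor
  · rintro (⟨i, hi, h⟩ | ⟨i, hi, h⟩)
    · simp at h
    · exact .inl ⟨i, hi, by simp only [sr.injEq] at h; rw [h, dCoeff, ← mul_assoc]; simp⟩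
  · rintro (⟨i, hi, h⟩ | ⟨i, hi, h⟩)
    · exact .inr ⟨i, hi, by
        simp only [r.injEq] at h; rw [dCoeff, ← h, ← mul_assoc]; simp⟩
    · simp at h

theorem adj_r_r (hμ : 1 + (lam : ZMod n) ^ 2 + ((lam : ZMod n) ^ 2) ^ 2 = 0) (i j : ZMod n) :
    (gammaGraph n 3 lam).Adj (Sum.inl (r i)) (Sum.inr (r j)) ↔
      j - i ∈ triangle ((lam : ZMod n) ^ 2) := by
  rw [adj_inl_inr, inv_r, r_mul_r, r_mem hμ, sub_eq_add_neg]

theorem adj_r_sr (hμ : 1 + (lam : ZMod n) ^ 2 + ((lam : ZMod n) ^ 2) ^ 2 = 0) (i j : ZMod n) :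
    (gammaGraph n 3 lam).Adj (Sum.inl (r i)) (Sum.inr (sr j)) ↔
      (lam⁻¹ : (ZMod n)ˣ) * (j - i) ∈ triangle ((lam : ZMod n) ^ 2) := by
  rw [adj_inl_inr, inv_r, sr_mul_r, sr_mem hμ, sub_eq_add_neg]

theorem adj_sr_sr (hμ : 1 + (lam : ZMod n) ^ 2 + ((lam : ZMod n) ^ 2) ^ 2 = 0) (i j : ZMod n) :
    (gammaGraph n 3 lam).Adj (Sum.inl (sr i)) (Sum.inr (sr j)) ↔
      i - j ∈ triangle ((lam : ZMod n) ^ 2) := by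
  rw [adj_inl_inr, inv_sr, sr_mul_sr, r_mem hμ]

theorem adj_sr_r (hμ : 1 + (lam : ZMod n) ^ 2 + ((lam : ZMod n) ^ 2) ^ 2 = 0) (i j : ZMod n) :
    (gammaGraph n 3 lam).Adj (Sum.inl (sr i)) (Sum.inr (r j)) ↔
      (lam⁻¹ : (ZMod n)ˣ) * (i - j) ∈ triangle ((lam : ZMod n) ^ 2) := by
  rw [adj_inl_inr, inv_sr, r_mul_sr, sr_mem hμ]

/-! ### Generating automorphisms and edge-transitivity -/

/-- The permutation of vertices underlying `rot`: on the first copy of `Dₙ` the group automorphism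
`a ↦ a^λ`, `b ↦ b a`, and on the second copy the same automorphism followed by left multiplication
by `b`. -/
def rotEquiv (lam : (ZMod n)ˣ) :
    DihedralGroup n ⊕ DihedralGroup n ≃ DihedralGroup n ⊕ DihedralGroup n where
  toFun
    | Sum.inl (r i) => Sum.inl (r (lam * i))
    | Sum.inl (sr i) => Sum.inl (sr (lam * i + 1))
    | Sum.inr (r i) => Sum.inr (sr (lam * i))
    | Sum.inr (sr i) => Sum.inr (r (lam * i + 1))
  invFun
    | Sum.inl (r i) => Sum.inl (r ((lam⁻¹ : (ZMod n)ˣ) * i))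
    | Sum.inl (sr i) => Sum.inl (sr ((lam⁻¹ : (ZMod n)ˣ) * (i - 1)))
    | Sum.inr (r i) => Sum.inr (sr ((lam⁻¹ : (ZMod n)ˣ) * (i - 1)))
    | Sum.inr (sr i) => Sum.inr (r ((lam⁻¹ : (ZMod n)ˣ) * i))
  left_inv := by rintro ((i | i) | (i | i)) <;> simp
  right_inv := by rintro ((i | i) | (i | i)) <;> simp

/-- The automorphism of the graph that fixes `1₀` and permutes the neighbours of `1₀` in a cycle of
length six. -/
def rot (hμ : 1 + (lam : ZMod n) ^ 2 + ((lam : ZMod n) ^ 2) ^ 2 = 0) :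
    gammaGraph n 3 lam ≃g gammaGraph n 3 lam where
  toEquiv := rotEquiv lam
  map_rel_iff' := by
    have aux : ∀ x y : DihedralGroup n, (gammaGraph n 3 lam).Adj
        (rotEquiv lam (Sum.inl x)) (rotEquiv lam (Sum.inr y)) ↔
          (gammaGraph n 3 lam).Adj (Sum.inl x) (Sum.inr y) := by
      have h₁ : ∀ x : ZMod n, (lam⁻¹ : (ZMod n)ˣ) * (lam * x) = x := by simp
      have h₂ : ∀ x : ZMod n, lam * x + 1 ∈ triangle ((lam : ZMod n) ^ 2) ↔
          (lam⁻¹ : (ZMod n)ˣ) * x ∈ triangle ((lam : ZMod n) ^ 2) := fun x => by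
        rw [← triangle.mul_add_one_mem_iff hμ (x := (lam⁻¹ : (ZMod n)ˣ) * x),
          show (lam : ZMod n) ^ 2 * ((lam⁻¹ : (ZMod n)ˣ) * x) = lam * x by
            rw [sq, mul_assoc, Units.mul_inv_cancel_left]]
      rintro (i | i) (j | j)
      · simp only [rotEquiv, Equiv.coe_fn_mk, adj_r_sr hμ, adj_r_r hμ, ← mul_sub, h₁]
      · simp only [rotEquiv, Equiv.coe_fn_mk, adj_r_sr hμ, adj_r_r hμ, ← h₂]
        ring_nf
      · simp only [rotEquiv, Equiv.coe_fn_mk, adj_sr_sr hμ, adj_sr_r hμ, ← h₂]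
        ring_nf
      · simp only [rotEquiv, Equiv.coe_fn_mk, adj_sr_sr hμ, adj_sr_r hμ, add_sub_add_right_eq_sub,
          ← mul_sub, h₁]
    have hl : ∀ x, ∃ y, rotEquiv lam (Sum.inl x) = Sum.inl y := by
      rintro (i | i) <;> exact ⟨_, rfl⟩
    have hr : ∀ x, ∃ y, rotEquiv lam (Sum.inr x) = Sum.inr y := by
      rintro (i | i) <;> exact ⟨_, rfl⟩
    rintro (x | x) (y | y)
    · obtain ⟨x', hx⟩ := hl x
      obtain ⟨y', hy⟩ := hl y
      simp only [hx, hy, not_adj_inl_inl]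
    · exact aux x y
    · rw [SimpleGraph.adj_comm, aux, adj_inr_inl]
    · obtain ⟨x', hx⟩ := hr x
      obtain ⟨y', hy⟩ := hr y
      simp only [hx, hy, not_adj_inr_inr]

section

variable (hμ : 1 + (lam : ZMod n) ^ 2 + ((lam : ZMod n) ^ 2) ^ 2 = 0)

@[simp] theorem rot_inl_r (i : ZMod n) :
    rot hμ (Sum.inl (r i)) = Sum.inl (r ((lam : ZMod n) * i)) := rfl

@[simp] theorem rot_inl_sr (i : ZMod n) :
    rot hμ (Sum.inl (sr i)) = Sum.inl (sr ((lam : ZMod n) * i + 1)) := rfl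

@[simp] theorem rot_inr_r (i : ZMod n) :
    rot hμ (Sum.inr (r i)) = Sum.inr (sr ((lam : ZMod n) * i)) := rfl

@[simp] theorem rot_inr_sr (i : ZMod n) :
    rot hμ (Sum.inr (sr i)) = Sum.inr (r ((lam : ZMod n) * i + 1)) := rfl

theorem rot_pow_inl_one (k : ℕ) : (rot hμ ^ k) (Sum.inl 1) = Sum.inl 1 := by
  induction k with
  | zero => rfl
  | succ k ih =>
    rw [pow_succ', RelIso.mul_apply, ih, one_def, rot_inl_r, mul_zero]

theorem exists_rot_pow_inr_one {z : DihedralGroup n} (hz : z ∈ gammaSet n 3 lam) :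
    ∃ k : ℕ, (rot hμ ^ k) (Sum.inr 1) = Sum.inr z := by
  rcases z with x | x
  · rw [r_mem hμ, triangle.mem_iff] at hz
    rcases hz with rfl | rfl | rfl
    · exact ⟨0, rfl⟩
    · exact ⟨2, by simp [pow_succ, one_def, RelIso.mul_apply, -r_zero]⟩
    · exact ⟨4, by simp [pow_succ, one_def, RelIso.mul_apply, -r_zero]; ring⟩
  · rw [sr_mem hμ, triangle.mem_iff] at hz
    rcases hz with h | h | h <;> rw [Units.inv_mul_eq_iff_eq_mul] at h <;> subst h
    · exact ⟨1, by simp [one_def, -r_zero]⟩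
    · exact ⟨3, by simp [pow_succ, one_def, RelIso.mul_apply, -r_zero]⟩
    · exact ⟨5, by simp [pow_succ, one_def, RelIso.mul_apply, -r_zero]; ring⟩

theorem rot_pow_six_inr_one : (rot hμ ^ 6) (Sum.inr 1) = Sum.inr 1 := by
  simp [pow_succ, one_def, RelIso.mul_apply, -r_zero]
  linear_combination hμ

end

/-- The homomorphism from `Dₙ` with image `R(Dₙ)`; it sends `g` to `hᵢ ↦ (h g⁻¹)ᵢ`. -/
def transl (lam : (ZMod n)ˣ) : DihedralGroup n →* (gammaGraph n 3 lam ≃g gammaGraph n 3 lam) :=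
  biCayRight ∅ ∅ (gammaSet n 3 lam)

@[simp] theorem transl_inl (g x : DihedralGroup n) :
    transl lam g (Sum.inl x) = Sum.inl (x * g⁻¹) := rfl

@[simp] theorem transl_inr (g x : DihedralGroup n) :
    transl lam g (Sum.inr x) = Sum.inr (x * g⁻¹) := rfl

/-- The automorphisms in `R(Dₙ)⟨rot⟩` act transitively on the edges, and preserve the sides. -/
theorem exists_transl_mul_rot_pow (hμ : 1 + (lam : ZMod n) ^ 2 + ((lam : ZMod n) ^ 2) ^ 2 = 0)
    {x y : DihedralGroup n} (h : (gammaGraph n 3 lam).Adj (Sum.inl x) (Sum.inr y)) :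
    ∃ (g : DihedralGroup n) (k : ℕ), (transl lam g * rot hμ ^ k) (Sum.inl 1) = Sum.inl x ∧
      (transl lam g * rot hμ ^ k) (Sum.inr 1) = Sum.inr y := by
  obtain ⟨k, hk⟩ := exists_rot_pow_inr_one hμ ((adj_inl_inr x y).1 h)
  exact ⟨x⁻¹, k, by rw [RelIso.mul_apply, rot_pow_inl_one, transl_inl]; simp,
    by rw [RelIso.mul_apply, hk, transl_inr]; simp⟩

theorem one_adj (hμ : 1 + (lam : ZMod n) ^ 2 + ((lam : ZMod n) ^ 2) ^ 2 = 0) :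
    (gammaGraph n 3 lam).Adj (Sum.inl 1) (Sum.inr 1) := by
  rw [one_def, adj_r_r hμ, sub_self]
  exact triangle.zero_mem _

theorem exists_of_mem_edgeSet {e : Sym2 (DihedralGroup n ⊕ DihedralGroup n)}
    (he : e ∈ (gammaGraph n 3 lam).edgeSet) :
    ∃ x y, (gammaGraph n 3 lam).Adj (Sum.inl x) (Sum.inr y) ∧ e = s(Sum.inl x, Sum.inr y) := by
  induction e with | _ u v
  rw [SimpleGraph.mem_edgeSet] at he
  rcases u with u | u <;> rcases v with v | v
  · exact absurd he (not_adj_inl_inl _ _)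
  · exact ⟨u, v, he, rfl⟩
  · exact ⟨v, u, he.symm, Sym2.eq_swap⟩
  · exact absurd he (not_adj_inr_inr _ _)

theorem isEdgeTransitive (hμ : 1 + (lam : ZMod n) ^ 2 + ((lam : ZMod n) ^ 2) ^ 2 = 0) :
    IsEdgeTransitive (gammaGraph n 3 lam) := by
  intro e he f hf
  obtain ⟨x, y, hxy, rfl⟩ := exists_of_mem_edgeSet he
  obtain ⟨x', y', hxy', rfl⟩ := exists_of_mem_edgeSet hf
  obtain ⟨a, i, h₁, h₂⟩ := exists_transl_mul_rot_pow hμ hxy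
  obtain ⟨b, j, h₃, h₄⟩ := exists_transl_mul_rot_pow hμ hxy'
  refine ⟨transl lam b * rot hμ ^ j * (transl lam a * rot hμ ^ i)⁻¹, ?_⟩
  rw [Sym2.map_mk, ← h₁, ← h₂, ← h₃, ← h₄, ← RelIso.mul_apply, ← RelIso.mul_apply,
    inv_mul_cancel_right]

theorem encard_neighborSet (v : DihedralGroup n ⊕ DihedralGroup n) :
    ((gammaGraph n 3 lam).neighborSet v).encard = (gammaSet n 3 lam).encard := by
  rcases v with x | x
  · have : (gammaGraph n 3 lam).neighborSet (Sum.inl x) =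
        (fun z => Sum.inr (z * x)) '' gammaSet n 3 lam := by
      ext (y | y)
      · simp [not_adj_inl_inl]
      · simp [adj_inl_inr, ← eq_mul_inv_iff_mul_eq]
    rw [this, Function.Injective.encard_image]
    exact fun a b h => by simpa using h
  · have : (gammaGraph n 3 lam).neighborSet (Sum.inr x) =
        (fun z => Sum.inl (z⁻¹ * x)) '' gammaSet n 3 lam := by
      ext (y | y)
      · simp [adj_inr_inl, adj_inl_inr, inv_mul_eq_iff_eq_mul, ← mul_inv_eq_iff_eq_mul]
      · simp [not_adj_inr_inr]
    rw [this, Function.Injective.encard_image]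
    exact fun a b h => by simpa using h

/-! ### The case `λ³ = -1` -/

/-- Some vertex other than `1₀` has the same neighbours as `1₀`, but no vertex other than `1₁` has
the same neighbours as `1₁`. -/
theorem not_isVertexTransitive_of_cube_eq_neg_one
    (hμ : 1 + (lam : ZMod n) ^ 2 + ((lam : ZMod n) ^ 2) ^ 2 = 0) (h2 : (2 : ZMod n) ≠ 0)
    (hμ1 : (lam : ZMod n) ^ 2 ≠ 1) (h : (lam : ZMod n) ^ 3 = -1) :
    ¬ IsVertexTransitive (gammaGraph n 3 lam) := by
  intro hvt
  have hlam : (lam : ZMod n) = 1 + (lam : ZMod n) ^ 2 := by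
    linear_combination (lam : ZMod n) * hμ - (lam : ZMod n) ^ 2 * h - h
  have hinv : ((lam⁻¹ : (ZMod n)ˣ) : ZMod n) = 1 - lam := by
    rw [← Units.mul_right_inj lam, Units.mul_inv]
    linear_combination -hlam
  -- `1 + μ - T = λT`.
  have key : ∀ x : ZMod n, (1 + (lam : ZMod n) ^ 2) - x ∈ triangle ((lam : ZMod n) ^ 2) ↔
      (lam⁻¹ : (ZMod n)ˣ) * x ∈ triangle ((lam : ZMod n) ^ 2) := fun x => by
    rw [hinv, triangle.mem_iff, triangle.mem_iff]
    grind
  obtain ⟨g, hg⟩ := hvt (Sum.inl 1) (Sum.inr 1)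
  have twin : ∀ v, (gammaGraph n 3 lam).Adj (Sum.inl 1) v ↔
      (gammaGraph n 3 lam).Adj (Sum.inl (sr (1 + (lam : ZMod n) ^ 2))) v := by
    rintro (v | (j | j))
    · simp only [not_adj_inl_inl]
    · rw [one_def, adj_r_r hμ, adj_sr_r hμ, ← key]; simp
    · rw [one_def, adj_r_sr hμ, adj_sr_sr hμ, key]; simp
  have twin' : ∀ v, (gammaGraph n 3 lam).Adj (Sum.inr 1) v ↔
      (gammaGraph n 3 lam).Adj (g (Sum.inl (sr (1 + (lam : ZMod n) ^ 2)))) v := by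
    intro v
    obtain ⟨w, rfl⟩ := g.surjective v
    rw [← hg, g.map_adj_iff, g.map_adj_iff, twin]
  have hne : g (Sum.inl (sr (1 + (lam : ZMod n) ^ 2))) ≠ Sum.inr 1 := by
    rw [← hg]
    exact fun e => by simpa [one_def, -r_zero] using g.injective e
  generalize g (Sum.inl (sr (1 + (lam : ZMod n) ^ 2))) = w at twin' hne
  have sw : ∀ x, Sum.inr x = w → ∀ y, (gammaGraph n 3 lam).Adj (Sum.inl y) (Sum.inr 1) ↔
      (gammaGraph n 3 lam).Adj (Sum.inl y) (Sum.inr x) := by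
    rintro x rfl y
    rw [SimpleGraph.adj_comm, twin', adj_inr_inl]
  rcases w with w | (j | j)
  · exact not_adj_inl_inl _ _ ((twin' (Sum.inl 1)).1 (one_adj hμ).symm)
  · refine hne (congrArg _ (congrArg r (triangle.eq_zero_of_add_mem h2 hμ hμ1 fun t ht => ?_)))
    have := (sw _ rfl (r (-t))).1 (by rw [one_def, adj_r_r hμ]; simpa using ht)
    rw [adj_r_r hμ] at this
    simpa using this
  · refine triangle.not_sub_mem h2 hμ hμ1 (1 + (lam : ZMod n) ^ 2 - j) fun t ht => ?_
    have := (sw _ rfl (r (-t))).1 (by rw [one_def, adj_r_r hμ]; simpa using ht)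
    rw [adj_r_sr hμ, ← key] at this
    convert this using 1
    ring

/-! ### The two kinds of edges -/

/-- The kind of a vertex `h₀` or `h₁`: whether `h` is a reflection `b aⁱ` (and not a rotation). -/
def IsReflection : DihedralGroup n ⊕ DihedralGroup n → Prop
  | Sum.inl (r _) => False
  | Sum.inl (sr _) => True
  | Sum.inr (r _) => False
  | Sum.inr (sr _) => True

/-- The graph is connected, in the form that a function constant along edges is constant. -/
theorem eq_of_adj_imp [NeZero n] (hμ : 1 + (lam : ZMod n) ^ 2 + ((lam : ZMod n) ^ 2) ^ 2 = 0)
    {α : Type*} (q : DihedralGroup n ⊕ DihedralGroup n → α)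
    (h : ∀ u v, (gammaGraph n 3 lam).Adj u v → q u = q v)
    (u v : DihedralGroup n ⊕ DihedralGroup n) : q u = q v := by
  have step : ∀ i : ZMod n, q (Sum.inl (r (i + 1))) = q (Sum.inl (r i)) := fun i =>
    (h _ (Sum.inr (r (i + 1))) (by
      rw [adj_r_r hμ, sub_self]; exact triangle.zero_mem _)).trans
    (h _ _ (by
      rw [adj_r_r hμ, add_sub_cancel_left]; exact triangle.one_mem _)).symm
  have hr : ∀ i : ZMod n, q (Sum.inl (r i)) = q (Sum.inl (r 0)) := fun i => by
    rw [← ZMod.natCast_zmod_val i]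
    induction i.val with
    | zero => simp
    | succ k ih => rw [Nat.cast_succ, step, ih]
  have all : ∀ u, q u = q (Sum.inl (r 0)) := by
    have hr' : ∀ i : ZMod n, q (Sum.inr (r i)) = q (Sum.inl (r 0)) := fun i => by
      rw [← hr i]
      exact (h _ _ (by rw [adj_r_r hμ, sub_self]; exact triangle.zero_mem _)).symm
    rintro ((i | i) | (i | i))
    · exact hr i
    · rw [← hr' i]
      exact h _ _ (by rw [adj_sr_r hμ, sub_self, mul_zero]; exact triangle.zero_mem _)
    · exact hr' i
    · rw [← hr i]
      exact (h _ _ (by rw [adj_r_sr hμ, sub_self, mul_zero]; exact triangle.zero_mem _)).symm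
  rw [all u, all v]

/-- The arithmetic conditions under which the graph is rigid. They hold for every `λ` of order `6`
with `1 + λ² + λ⁴ = 0` and `λ³ ≠ -1` as soon as `5 ≤ n`. -/
structure IsGeneric (lam : (ZMod n)ˣ) : Prop where
  two_ne_zero : (2 : ZMod n) ≠ 0
  three_ne_zero : (3 : ZMod n) ≠ 0
  seven_ne_zero : (7 : ZMod n) ≠ 0
  sum_eq_zero : 1 + (lam : ZMod n) ^ 2 + ((lam : ZMod n) ^ 2) ^ 2 = 0
  sq_ne_one : (lam : ZMod n) ^ 2 ≠ 1
  cube_ne_one : (lam : ZMod n) ^ 3 ≠ 1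
  cube_ne_neg_one : (lam : ZMod n) ^ 3 ≠ -1

/-- Two neighbours of `v` in the same block have no common neighbour besides `v`. -/
theorem eq_of_isReflection_iff (H : IsGeneric lam)
    {v v' u w : DihedralGroup n ⊕ DihedralGroup n} (hvu : (gammaGraph n 3 lam).Adj v u)
    (hvw : (gammaGraph n 3 lam).Adj v w) (hvu' : (gammaGraph n 3 lam).Adj v' u)
    (hvw' : (gammaGraph n 3 lam).Adj v' w) (huw : u ≠ w)
    (hk : IsReflection u ↔ IsReflection w) : v' = v := by
  have hμ := H.sum_eq_zero
  -- A nonzero difference of points of `T` is not a difference of points of `λT`.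
  have mixed : ∀ {s t s' t' : ZMod n}, s ∈ triangle ((lam : ZMod n) ^ 2) →
      t ∈ triangle ((lam : ZMod n) ^ 2) →
      (lam⁻¹ : (ZMod n)ˣ) * s' ∈ triangle ((lam : ZMod n) ^ 2) →
      (lam⁻¹ : (ZMod n)ˣ) * t' ∈ triangle ((lam : ZMod n) ^ 2) → s ≠ t → s - t ≠ s' - t' := by
    intro s t s' t' hs ht hs' ht' hst h
    have hcube : (s - t) ^ 3 =
        lam ^ 3 * ((lam⁻¹ : (ZMod n)ˣ) * s' - (lam⁻¹ : (ZMod n)ˣ) * t') ^ 3 := by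
      rw [← mul_pow, ← mul_sub, Units.mul_inv_cancel_left, h]
    have hst' : (lam⁻¹ : (ZMod n)ˣ) * s' ≠ (lam⁻¹ : (ZMod n)ˣ) * t' := fun e =>
      hst (by rw [← sub_eq_zero, h, sub_eq_zero]; exact (Units.mul_right_inj _).1 e)
    rcases triangle.sub_cube H.sum_eq_zero hs ht hst with a | a <;>
      rcases triangle.sub_cube H.sum_eq_zero hs' ht' hst' with b | b <;> rw [a, b] at hcube <;>
        grind [H.cube_ne_one, H.cube_ne_neg_one]
  have uniq := @triangle.eq_of_sub_eq_sub _ _ _ H.two_ne_zero H.sum_eq_zero H.sq_ne_one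
  rcases u with (i | i) | (i | i) <;> rcases w with (j | j) | (j | j) <;>
    first
    | (exfalso; simp [IsReflection] at hk; done)
    | (rcases v with (k | k) | (k | k) <;>
        first
        | exact absurd hvu (not_adj_inl_inl _ _)
        | exact absurd hvu (not_adj_inr_inr _ _)
        | exact absurd hvw (not_adj_inl_inl _ _)
        | exact absurd hvw (not_adj_inr_inr _ _)
        | (have hij : i ≠ j := by rintro rfl; exact huw rfl
           rcases v' with (m | m) | (m | m) <;>
            first
            | exact absurd hvu' (not_adj_inl_inl _ _)
            | exact absurd hvu' (not_adj_inr_inr _ _)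
            | (simp only [adj_inr_inl, adj_r_r hμ, adj_r_sr hμ, adj_sr_r hμ, adj_sr_sr hμ]
                at hvu hvw hvu' hvw'
               first
               | exact absurd (by ring1) (mixed hvu hvw hvu' hvw' (by simpa using hij))
               | exact absurd (by ring1) (mixed hvu hvw hvw' hvu' (by simpa using hij))
               | exact absurd (by ring1) (mixed hvu' hvw' hvu hvw (by simpa using hij))
               | exact absurd (by ring1) (mixed hvu' hvw' hvw hvu (by simpa using hij))
               | (have := uniq hvu hvw hvu' hvw' (by simpa using hij) (by ring1)
                  congr 2
                  simpa using this.symm))))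

/-- If `v` has neighbours in two blocks, with coordinates `i` and `j`, and `v` has coordinate `k`,
then a fourth vertex, with coordinate `i + j - k`, completes a 4-cycle. -/
theorem exists_ne_of_not_isReflection_iff
    (hμ : 1 + (lam : ZMod n) ^ 2 + ((lam : ZMod n) ^ 2) ^ 2 = 0)
    {v u w : DihedralGroup n ⊕ DihedralGroup n} (hvu : (gammaGraph n 3 lam).Adj v u)
    (hvw : (gammaGraph n 3 lam).Adj v w) (hk : ¬ (IsReflection u ↔ IsReflection w)) :
    ∃ v', (gammaGraph n 3 lam).Adj v' u ∧ (gammaGraph n 3 lam).Adj v' w ∧ v' ≠ v := by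
  rcases u with (i | i) | (i | i) <;> rcases w with (j | j) | (j | j) <;>
    first
    | (exfalso; simp [IsReflection] at hk; done)
    | (rcases v with (k | k) | (k | k) <;>
        first
        | exact absurd hvu (not_adj_inl_inl _ _)
        | exact absurd hvu (not_adj_inr_inr _ _)
        | exact absurd hvw (not_adj_inl_inl _ _)
        | exact absurd hvw (not_adj_inr_inr _ _)
        | (first
            | (refine ⟨Sum.inl (sr (i + j - k)), ?_, ?_, Sum.inl_injective.ne ?_⟩
               rotate_left 2
               focus (simp; done))
            | (refine ⟨Sum.inl (r (i + j - k)), ?_, ?_, Sum.inl_injective.ne ?_⟩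
               rotate_left 2
               focus simp)
            | (refine ⟨Sum.inr (sr (i + j - k)), ?_, ?_, Sum.inr_injective.ne ?_⟩
               rotate_left 2
               focus (simp; done))
            | (refine ⟨Sum.inr (r (i + j - k)), ?_, ?_, Sum.inr_injective.ne ?_⟩
               rotate_left 2
               focus simp)
           all_goals
            simp only [adj_inr_inl, adj_r_r hμ, adj_r_sr hμ, adj_sr_r hμ, adj_sr_sr hμ]
              at hvu hvw ⊢
            first
            | (convert hvu using 1; ring1)
            | (convert hvw using 1; ring1)))

theorem isReflection_iff_of_adj (H : IsGeneric lam)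
    {u v w : DihedralGroup n ⊕ DihedralGroup n} (hvu : (gammaGraph n 3 lam).Adj v u)
    (hvw : (gammaGraph n 3 lam).Adj v w) (huw : u ≠ w) :
    (IsReflection u ↔ IsReflection w) ↔
      ∀ v', (gammaGraph n 3 lam).Adj v' u → (gammaGraph n 3 lam).Adj v' w → v' = v := by
  refine ⟨fun hk v' hu hw => eq_of_isReflection_iff H hvu hvw hu hw huw hk,
    fun h => ?_⟩
  by_contra hk
  obtain ⟨v', hu, hw, hne⟩ := exists_ne_of_not_isReflection_iff H.sum_eq_zero hvu hvw hk
  exact hne (h v' hu hw)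

/-- An automorphism that maps the vertices `1₀` and `1₁` to rotations preserves the kind of every
vertex. -/
theorem isReflection_apply_iff [NeZero n] (H : IsGeneric lam)
    (g : gammaGraph n 3 lam ≃g gammaGraph n 3 lam)
    (h₀ : ¬ IsReflection (g (Sum.inl 1))) (h₁ : ¬ IsReflection (g (Sum.inr 1)))
    (v : DihedralGroup n ⊕ DihedralGroup n) : IsReflection (g v) ↔ IsReflection v := by
  -- Agreement in kind of two neighbours of a vertex is expressed by common neighbours.
  have pair : ∀ {v u w}, (gammaGraph n 3 lam).Adj v u → (gammaGraph n 3 lam).Adj v w →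
      ((IsReflection (g u) ↔ IsReflection (g w)) ↔ (IsReflection u ↔ IsReflection w)) := by
    intro v u w hu hw
    by_cases huw : u = w
    · simp [huw]
    rw [isReflection_iff_of_adj H hu hw huw,
      isReflection_iff_of_adj H (g.map_adj_iff.2 hu) (g.map_adj_iff.2 hw)
        (g.injective.ne huw), g.surjective.forall]
    simp only [g.map_adj_iff, g.injective.eq_iff]
  have n₀ : ¬ IsReflection (Sum.inl (1 : DihedralGroup n)) := id
  have n₁ : ¬ IsReflection (Sum.inr (1 : DihedralGroup n)) := id
  -- If agreement in kind along one edge at `v` is preserved, then it is preserved along all.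
  have edge : ∀ v, ∀ w, (gammaGraph n 3 lam).Adj v w →
      ((IsReflection (g v) ↔ IsReflection (g w)) ↔ (IsReflection v ↔ IsReflection w)) := by
    intro v
    rw [eq_of_adj_imp H.sum_eq_zero (fun v => ∀ w, (gammaGraph n 3 lam).Adj v w →
      ((IsReflection (g v) ↔ IsReflection (g w)) ↔ (IsReflection v ↔ IsReflection w)))
      (fun u v huv => ?_) v (Sum.inl 1)]
    · intro w hw
      have := pair hw (one_adj H.sum_eq_zero)
      grind
    · apply propext
      constructor
      · intro H w hw
        have a := H v huv
        have b := pair huv.symm hw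
        grind
      · intro H w hw
        have a := H u huv.symm
        have b := pair huv hw
        grind
  have := eq_of_adj_imp H.sum_eq_zero (fun v => (IsReflection (g v) ↔ IsReflection v))
    (fun u v huv => propext (by have := edge u v huv; grind)) v (Sum.inl 1)
  rw [this]
  grind

/-- An automorphism preserves the sides of all vertices or exchanges them. -/
theorem isLeft_apply_eq_iff [NeZero n]
    (hμ : 1 + (lam : ZMod n) ^ 2 + ((lam : ZMod n) ^ 2) ^ 2 = 0)
    (g : gammaGraph n 3 lam ≃g gammaGraph n 3 lam)
    (u v : DihedralGroup n ⊕ DihedralGroup n) :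
    ((g u).isLeft = u.isLeft) ↔ ((g v).isLeft = v.isLeft) := by
  have adj : ∀ {u v}, (gammaGraph n 3 lam).Adj u v → u.isLeft ≠ v.isLeft := by
    rintro (u | u) (v | v) h
    · exact absurd h (not_adj_inl_inl _ _)
    · simp
    · simp
    · exact absurd h (not_adj_inr_inr _ _)
  refine iff_of_eq (eq_of_adj_imp hμ (fun v => (g v).isLeft = v.isLeft) (fun u v h => ?_) u v)
  have a := adj h
  have b := adj (g.map_adj_iff.2 h)
  revert a b
  cases u.isLeft <;> cases v.isLeft <;> cases (g u).isLeft <;> cases (g v).isLeft <;> simp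

/-! ### Rigidity of the graph -/

theorem exists_eq_inl_r {v : DihedralGroup n ⊕ DihedralGroup n} (hk : ¬ IsReflection v)
    (hs : v.isLeft = true) : ∃ j, v = Sum.inl (r j) := by
  rcases v with (j | j) | (j | j) <;> simp_all [IsReflection]

theorem exists_eq_inr_r {v : DihedralGroup n ⊕ DihedralGroup n} (hk : ¬ IsReflection v)
    (hs : v.isLeft = false) : ∃ j, v = Sum.inr (r j) := by
  rcases v with (j | j) | (j | j) <;> simp_all [IsReflection]

theorem exists_eq_inl_sr {v : DihedralGroup n ⊕ DihedralGroup n} (hk : IsReflection v)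
    (hs : v.isLeft = true) : ∃ j, v = Sum.inl (sr j) := by
  rcases v with (j | j) | (j | j) <;> simp_all [IsReflection]

theorem exists_eq_inr_sr {v : DihedralGroup n ⊕ DihedralGroup n} (hk : IsReflection v)
    (hs : v.isLeft = false) : ∃ j, v = Sum.inr (sr j) := by
  rcases v with (j | j) | (j | j) <;> simp_all [IsReflection]

theorem exists_injective_of_forall_exists {α β γ : Type*} {g : β → γ} (hg : Function.Injective g)
    {B : α → β} (hB : Function.Injective B) {B' : α → γ} (h : ∀ i, ∃ j, g (B i) = B' j) :
    ∃ f : α → α, Function.Injective f ∧ ∀ i, g (B i) = B' (f i) := by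
  choose f hf using h
  exact ⟨f, fun x y e => hB (hg (by rw [hf, hf, e])), hf⟩

theorem eq_one_of_fixes_edge [NeZero n] (H : IsGeneric lam)
    {g : gammaGraph n 3 lam ≃g gammaGraph n 3 lam}
    (h₀ : g (Sum.inl 1) = Sum.inl 1) (h₁ : g (Sum.inr 1) = Sum.inr 1) : g = 1 := by
  have hμ := H.sum_eq_zero
  have kind := isReflection_apply_iff H g (by rw [h₀]; exact id)
    (by rw [h₁]; exact id)
  have side : ∀ v, (g v).isLeft = v.isLeft := fun v =>
    (isLeft_apply_eq_iff hμ g (Sum.inl 1) v).1 (by rw [h₀])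
  obtain ⟨f₀, i₀, e₀⟩ := exists_injective_of_forall_exists g.injective
    (B := fun i => Sum.inl (r i)) (B' := fun j => Sum.inl (r j)) (fun _ _ h => by simpa using h)
    fun i => exists_eq_inl_r ((kind _).not.2 id) (side _)
  obtain ⟨f₁, i₁, e₁⟩ := exists_injective_of_forall_exists g.injective
    (B := fun i => Sum.inr (r i)) (B' := fun j => Sum.inr (r j)) (fun _ _ h => by simpa using h)
    fun i => exists_eq_inr_r ((kind _).not.2 id) (side _)
  obtain ⟨f₂, i₂, e₂⟩ := exists_injective_of_forall_exists g.injective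
    (B := fun i => Sum.inl (sr i)) (B' := fun j => Sum.inl (sr j)) (fun _ _ h => by simpa using h)
    fun i => exists_eq_inl_sr ((kind _).2 trivial) (side _)
  obtain ⟨f₃, i₃, e₃⟩ := exists_injective_of_forall_exists g.injective
    (B := fun i => Sum.inr (sr i)) (B' := fun j => Sum.inr (sr j)) (fun _ _ h => by simpa using h)
    fun i => exists_eq_inr_sr ((kind _).2 trivial) (side _)
  have z₀ : f₀ 0 = 0 := by simpa [one_def, -r_zero, e₀] using h₀
  have z₁ : f₁ 0 = 0 := by simpa [one_def, -r_zero, e₁] using h₁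
  obtain ⟨u, e, hue, a₀, a₁⟩ := triangle.rigid_smul H.two_ne_zero H.three_ne_zero
      H.seven_ne_zero hμ H.sq_ne_one i₀ i₁ 1 1 (fun x y h => by
    rw [Units.val_one, one_mul] at h ⊢
    rwa [← adj_r_r hμ, ← e₀, ← e₁, g.map_adj_iff, adj_r_r hμ])
  obtain rfl : e = 0 := by simpa [z₀, z₁] using (a₁ 0).symm
  obtain ⟨h10, -, h01⟩ := triangle.ne_zero_and_ne_zero H.two_ne_zero hμ
  obtain rfl : u = 1 := by
    rcases hue with h | h | h
    · exact h.1
    · exact absurd h.2.symm h10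
    · exact absurd h.2.symm h01
  have b₀ : ∀ x, f₀ x = x := fun x => by simpa [z₀] using a₀ x
  have b₁ : ∀ x, f₁ x = x := fun x => by simpa [b₀] using a₁ x
  have b₃ : ∀ x, f₃ x = x :=
    triangle.rigid_of_eq_id H.two_ne_zero H.three_ne_zero
      H.seven_ne_zero hμ H.sq_ne_one b₀ i₃ lam⁻¹ fun x y h => by
      rwa [← adj_r_sr hμ, ← e₀, ← e₃, g.map_adj_iff, adj_r_sr hμ]
  have b₂ : ∀ x, f₂ x = x :=
    triangle.rigid_of_eq_id H.two_ne_zero H.three_ne_zero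
      H.seven_ne_zero hμ H.sq_ne_one b₃ i₂ 1 fun x y h => by
      rw [Units.val_one, one_mul] at h ⊢
      rwa [← adj_sr_sr hμ, ← e₂, ← e₃, g.map_adj_iff, adj_sr_sr hμ]
  ext v
  rcases v with (i | i) | (i | i)
  · simp [e₀, b₀]
  · simp [e₂, b₂]
  · simp [e₁, b₁]
  · simp [e₃, b₃]

/-- No automorphism exchanges `1₀` and `1₁`: it would act on the rotations of the first side with a
multiplier that is both a power of `μ` and the negative of one. -/
theorem not_swaps_edge [NeZero n] (H : IsGeneric lam)
    {g : gammaGraph n 3 lam ≃g gammaGraph n 3 lam}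
    (h₀ : g (Sum.inl 1) = Sum.inr 1) : g (Sum.inr 1) ≠ Sum.inl 1 := by
  intro h₁
  have hμ := H.sum_eq_zero
  have kind := isReflection_apply_iff H g (by rw [h₀]; exact id)
    (by rw [h₁]; exact id)
  have side : ∀ v, (g v).isLeft = !v.isLeft := fun v => by
    rw [← Bool.not_eq_not, Bool.not_not, ← isLeft_apply_eq_iff hμ g (Sum.inl 1) v, h₀]
    simp
  obtain ⟨f₀, i₀, e₀⟩ := exists_injective_of_forall_exists g.injective
    (B := fun i => Sum.inl (r i)) (B' := fun j => Sum.inr (r j)) (fun _ _ h => by simpa using h)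
    fun i => exists_eq_inr_r ((kind _).not.2 id) (side _)
  obtain ⟨f₁, i₁, e₁⟩ := exists_injective_of_forall_exists g.injective
    (B := fun i => Sum.inr (r i)) (B' := fun j => Sum.inl (r j)) (fun _ _ h => by simpa using h)
    fun i => exists_eq_inl_r ((kind _).not.2 id) (side _)
  obtain ⟨f₃, i₃, e₃⟩ := exists_injective_of_forall_exists g.injective
    (B := fun i => Sum.inr (sr i)) (B' := fun j => Sum.inl (sr j)) (fun _ _ h => by simpa using h)
    fun i => exists_eq_inl_sr ((kind _).2 trivial) (side _)
  obtain ⟨u, e, hue, a₀, -⟩ := triangle.rigid_smul H.two_ne_zero H.three_ne_zero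
      H.seven_ne_zero hμ H.sq_ne_one i₀ i₁ 1 (-1) (fun x y h => by
    rw [Units.val_one, one_mul] at h
    rw [Units.val_neg, Units.val_one, neg_one_mul, neg_sub]
    rwa [← adj_r_r hμ, ← adj_inr_inl, ← e₀, ← e₁, g.map_adj_iff, adj_r_r hμ])
  obtain ⟨u', e', hue', a₀', -⟩ :=
    triangle.rigid_smul H.two_ne_zero H.three_ne_zero
      H.seven_ne_zero hμ H.sq_ne_one i₀ i₃ lam⁻¹ lam⁻¹ (fun x y h => by
      rwa [← adj_sr_r hμ, ← adj_inr_inl, ← e₀, ← e₃, g.map_adj_iff, adj_r_sr hμ])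
  have cube : ∀ {u e : ZMod n}, (u = 1 ∧ e = 0 ∨ u = (lam : ZMod n) ^ 2 ∧ e = 1 ∨
      u = ((lam : ZMod n) ^ 2) ^ 2 ∧ e = 1 + (lam : ZMod n) ^ 2) → u ^ 3 = 1 := by
    intro u e h
    have h3 : ((lam : ZMod n) ^ 2) ^ 3 = 1 := by
      linear_combination ((lam : ZMod n) ^ 2 - 1) * hμ
    rcases h with ⟨rfl, -⟩ | ⟨rfl, -⟩ | ⟨rfl, -⟩
    · rw [one_pow]
    · exact h3
    · rw [pow_right_comm, h3, one_pow]
  have hu : u' = -u := by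
    have a := a₀ lam
    have b := a₀' lam
    have l : (lam : ZMod n) * (lam⁻¹ : (ZMod n)ˣ) = 1 := Units.mul_inv lam
    push_cast at a
    linear_combination -b - ((lam⁻¹ : (ZMod n)ˣ) : ZMod n) * a + (-u - u') * l
  have c := cube hue
  have c' := cube hue'
  rw [hu] at c'
  exact H.two_ne_zero (by linear_combination -c - c')

/-! ### The automorphism group -/

/-- No automorphism exchanges the two sides, for otherwise some automorphism would exchange the ends
of the edge `1₀1₁`. -/
theorem isLeft_apply [NeZero n] (H : IsGeneric lam)
    (g : gammaGraph n 3 lam ≃g gammaGraph n 3 lam) (v : DihedralGroup n ⊕ DihedralGroup n) :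
    (g v).isLeft = v.isLeft := by
  by_contra hv
  have hl := (isLeft_apply_eq_iff H.sum_eq_zero g (Sum.inl 1) v).not.2 hv
  have hr := (isLeft_apply_eq_iff H.sum_eq_zero g (Sum.inr 1) v).not.2 hv
  obtain ⟨x, hx⟩ : ∃ x, g (Sum.inl 1) = Sum.inr x := by
    cases h : g (Sum.inl 1) <;> simp_all
  obtain ⟨y, hy⟩ : ∃ y, g (Sum.inr 1) = Sum.inl y := by
    cases h : g (Sum.inr 1) <;> simp_all
  have hadj : (gammaGraph n 3 lam).Adj (Sum.inl y) (Sum.inr x) := by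
    rw [← hx, ← hy, g.map_adj_iff]
    exact (one_adj H.sum_eq_zero).symm
  obtain ⟨a, k, h₁, h₂⟩ := exists_transl_mul_rot_pow H.sum_eq_zero hadj
  refine not_swaps_edge H (g := (transl lam a * rot H.sum_eq_zero ^ k)⁻¹ * g) ?_ ?_
  · rw [RelIso.mul_apply, hx, ← h₂, RelIso.inv_apply_self]
  · rw [RelIso.mul_apply, hy, ← h₁, RelIso.inv_apply_self]

theorem exists_eq_transl_mul_rot_pow [NeZero n] (H : IsGeneric lam)
    (g : gammaGraph n 3 lam ≃g gammaGraph n 3 lam) :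
    ∃ (a : DihedralGroup n) (k : ℕ), g = transl lam a * rot H.sum_eq_zero ^ k := by
  have side := isLeft_apply H g
  obtain ⟨x, hx⟩ : ∃ x, g (Sum.inl 1) = Sum.inl x := by
    have := side (Sum.inl 1)
    cases h : g (Sum.inl 1) <;> simp_all
  obtain ⟨y, hy⟩ : ∃ y, g (Sum.inr 1) = Sum.inr y := by
    have := side (Sum.inr 1)
    cases h : g (Sum.inr 1) <;> simp_all
  have hadj : (gammaGraph n 3 lam).Adj (Sum.inl x) (Sum.inr y) := by
    rw [← hx, ← hy, g.map_adj_iff]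
    exact one_adj H.sum_eq_zero
  obtain ⟨a, k, h₁, h₂⟩ := exists_transl_mul_rot_pow H.sum_eq_zero hadj
  refine ⟨a, k, (inv_mul_eq_one.1 ?_).symm⟩
  refine eq_one_of_fixes_edge H ?_ ?_
  · rw [RelIso.mul_apply, hx, ← h₁, RelIso.inv_apply_self]
  · rw [RelIso.mul_apply, hy, ← h₂, RelIso.inv_apply_self]

theorem isEdgeRegular [NeZero n] (H : IsGeneric lam) :
    IsEdgeRegular (gammaGraph n 3 lam) := by
  refine ⟨isEdgeTransitive H.sum_eq_zero, fun e he g hg => ?_⟩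
  obtain ⟨x, y, hxy, rfl⟩ := exists_of_mem_edgeSet he
  obtain ⟨a, k, h₁, h₂⟩ := exists_transl_mul_rot_pow H.sum_eq_zero hxy
  have side := isLeft_apply H g
  rw [Sym2.map_mk, Sym2.eq_iff] at hg
  rcases hg with ⟨hx, hy⟩ | ⟨hx, hy⟩
  · rw [← conj_eq_one_iff (a := (transl lam a * rot H.sum_eq_zero ^ k)⁻¹), inv_inv]
    refine eq_one_of_fixes_edge H ?_ ?_
    · rw [RelIso.mul_apply, RelIso.mul_apply, h₁, hx, ← h₁, RelIso.inv_apply_self]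
    · rw [RelIso.mul_apply, RelIso.mul_apply, h₂, hy, ← h₂, RelIso.inv_apply_self]
  · have := side (Sum.inl x)
    rw [hx] at this
    simp at this

theorem orderOf_rot [NeZero n] (H : IsGeneric lam) :
    orderOf (rot H.sum_eq_zero) = 6 := by
  refine orderOf_eq_of_pow_and_pow_div_prime (by norm_num)
    (eq_one_of_fixes_edge H (rot_pow_inl_one H.sum_eq_zero 6) (rot_pow_six_inr_one H.sum_eq_zero))
    fun p hp hd he => ?_
  have hp6 : p ∈ Nat.primeFactors 6 := by simp [hp, hd]
  have hpf : Nat.primeFactors 6 = {2, 3} := by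
    rw [show 6 = 2 * 3 from rfl, Nat.primeFactors_mul (by norm_num) (by norm_num),
      Nat.Prime.primeFactors Nat.prime_two, Nat.Prime.primeFactors Nat.prime_three]
    rfl
  have he' := DFunLike.congr_fun he (Sum.inr 1)
  rw [hpf, Finset.mem_insert, Finset.mem_singleton] at hp6
  rcases hp6 with rfl | rfl
  · simp [pow_succ, one_def, RelIso.mul_apply, -r_zero] at he'
  · simp [pow_succ, one_def, RelIso.mul_apply, -r_zero] at he'
    exact (triangle.ne_zero_and_ne_zero H.two_ne_zero H.sum_eq_zero).1 he'

/-- `rot` normalizes `R(Dₙ)`. -/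
theorem rot_mul_transl_mul_inv_mem (hμ : 1 + (lam : ZMod n) ^ 2 + ((lam : ZMod n) ^ 2) ^ 2 = 0)
    (a : DihedralGroup n) : rot hμ * transl lam a * (rot hμ)⁻¹ ∈ (transl lam).range := by
  rcases a with i | i
  · refine ⟨r (lam * i), ?_⟩
    rw [eq_mul_inv_iff_mul_eq]
    ext ((j | j) | (j | j)) <;> simp [RelIso.mul_apply] <;> ring
  · refine ⟨sr (lam * i + 1), ?_⟩
    rw [eq_mul_inv_iff_mul_eq]
    ext ((j | j) | (j | j)) <;> simp [RelIso.mul_apply] <;> ring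

theorem normal_range_transl [NeZero n] (H : IsGeneric lam) :
    (transl lam).range.Normal := by
  refine ⟨fun x hx g => ?_⟩
  obtain ⟨a, k, rfl⟩ := exists_eq_transl_mul_rot_pow H g
  have key : rot H.sum_eq_zero ^ k * x * (rot H.sum_eq_zero ^ k)⁻¹ ∈ (transl lam).range := by
    induction k with
    | zero => simpa using hx
    | succ k ih =>
      obtain ⟨b, hb⟩ := ih
      have := rot_mul_transl_mul_inv_mem H.sum_eq_zero b
      rw [hb] at this
      convert this using 1
      rw [pow_succ']
      group
  have ha : transl lam a ∈ (transl lam).range := ⟨a, rfl⟩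
  convert mul_mem (mul_mem ha key) (inv_mem ha) using 1
  group

theorem isComplement'_stabilizer [NeZero n] (H : IsGeneric lam)
    (v : DihedralGroup n ⊕ DihedralGroup n) :
    (transl lam).range.IsComplement'
      (MulAction.stabilizer (gammaGraph n 3 lam ≃g gammaGraph n 3 lam) v) := by
  refine Subgroup.isComplement'_stabilizer v ?_ fun g => ?_
  · rintro ⟨_, a, rfl⟩ h
    have h' : transl lam a v = v := h
    obtain rfl : a = 1 := by rcases v with v | v <;> simpa using h'
    exact Subtype.ext (map_one _)
  · have side := isLeft_apply H g v
    obtain ⟨a, ha⟩ : ∃ a, transl lam a (g v) = v := by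
      rcases v with v | v
      · cases h : g (Sum.inl v) with
        | inl w => exact ⟨v⁻¹ * w, by rw [transl_inl]; simp⟩
        | inr w => simp [h] at side
      · cases h : g (Sum.inr v) with
        | inl w => simp [h] at side
        | inr w => exact ⟨v⁻¹ * w, by rw [transl_inr]; simp⟩
    exact ⟨⟨_, a, rfl⟩, ha⟩

theorem stabilizer_inl_one [NeZero n] (H : IsGeneric lam) :
    MulAction.stabilizer (gammaGraph n 3 lam ≃g gammaGraph n 3 lam)
      (Sum.inl 1 : DihedralGroup n ⊕ DihedralGroup n) = Subgroup.zpowers (rot H.sum_eq_zero) := by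
  apply le_antisymm
  · intro g hg
    obtain ⟨a, k, rfl⟩ := exists_eq_transl_mul_rot_pow H g
    have h' : (transl lam a * rot H.sum_eq_zero ^ k) (Sum.inl 1) = Sum.inl 1 := hg
    rw [RelIso.mul_apply, rot_pow_inl_one, transl_inl] at h'
    obtain rfl : a = 1 := by simpa using h'
    rw [map_one, one_mul]
    exact pow_mem (Subgroup.mem_zpowers _) k
  · rw [Subgroup.zpowers_le]
    exact rot_pow_inl_one H.sum_eq_zero 1

/-- All vertex stabilizers are complements of `R(Dₙ)`, so they are isomorphic to that of `1₀`, which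
`rot` generates. -/
theorem isCyclic_and_card_stabilizer [NeZero n] (H : IsGeneric lam)
    (v : DihedralGroup n ⊕ DihedralGroup n) :
    IsCyclic (MulAction.stabilizer (gammaGraph n 3 lam ≃g gammaGraph n 3 lam) v) ∧
      Nat.card (MulAction.stabilizer (gammaGraph n 3 lam ≃g gammaGraph n 3 lam) v) = 6 := by
  have := normal_range_transl H
  let e := ((isComplement'_stabilizer H
      (Sum.inl (1 : DihedralGroup n))).symm.QuotientMulEquiv).symm.trans
    (isComplement'_stabilizer H v).symm.QuotientMulEquiv
  have hz := stabilizer_inl_one H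
  have hc : IsCyclic (MulAction.stabilizer (gammaGraph n 3 lam ≃g gammaGraph n 3 lam)
      (Sum.inl 1 : DihedralGroup n ⊕ DihedralGroup n)) := by
    rw [hz]; infer_instance
  refine ⟨e.isCyclic.1 hc, ?_⟩
  rw [← Nat.card_congr e.toEquiv, hz, Nat.card_zpowers, orderOf_rot H]

end gammaGraph

theorem mainTheorem8 (n : ℕ) (hn : 5 ≤ n) (lam : (ZMod n)ˣ) (hord : orderOf lam = 6)
    (hsum : 1 + (lam : ZMod n) ^ 2 + (lam : ZMod n) ^ 4 = 0) :
    IsSemisymmetric (gammaGraph n 3 lam) ∧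
      ((lam : ZMod n) ^ 3 ≠ -1 →
        IsEdgeRegular (gammaGraph n 3 lam) ∧
        (∀ v : DihedralGroup n ⊕ DihedralGroup n,
          IsCyclic (MulAction.stabilizer (gammaGraph n 3 lam ≃g gammaGraph n 3 lam) v) ∧
          Nat.card (MulAction.stabilizer (gammaGraph n 3 lam ≃g gammaGraph n 3 lam) v) = 6) ∧
        (gammaRight n 3 lam).Normal ∧
        (∀ v : DihedralGroup n ⊕ DihedralGroup n,
          (gammaRight n 3 lam).IsComplement'
            (MulAction.stabilizer (gammaGraph n 3 lam ≃g gammaGraph n 3 lam) v))) := by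
  have : NeZero n := ⟨by omega⟩
  have hμ : 1 + (lam : ZMod n) ^ 2 + ((lam : ZMod n) ^ 2) ^ 2 = 0 := by
    rw [← pow_mul]; exact hsum
  have hpow : ∀ k, 0 < k → k < 6 → (lam : ZMod n) ^ k ≠ 1 := fun k h0 h6 h => by
    refine pow_ne_one_of_lt_orderOf h0.ne' (hord.symm ▸ h6) (Units.ext ?_)
    rw [Units.val_pow_eq_pow_val, h, Units.val_one]
  have hcast : ∀ k : ℕ, 0 < k → k < 5 → ((k : ℕ) : ZMod n) ≠ 0 := fun k h0 h5 h => by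
    have := Nat.le_of_dvd h0 ((ZMod.natCast_eq_zero_iff k n).1 h)
    omega
  have h2 : (2 : ZMod n) ≠ 0 := by exact_mod_cast hcast 2 (by norm_num) (by norm_num)
  have h3 : (3 : ZMod n) ≠ 0 := by exact_mod_cast hcast 3 (by norm_num) (by norm_num)
  have hμ1 := hpow 2 (by norm_num) (by norm_num)
  have h1 := hpow 3 (by norm_num) (by norm_num)
  have h7 : (lam : ZMod n) ^ 3 ≠ -1 → (7 : ZMod n) ≠ 0 := by
    intro hneg h
    have hd : n ∣ 7 := (ZMod.natCast_eq_zero_iff 7 n).1 (by exact_mod_cast h)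
    obtain rfl : n = 7 := by
      rcases (Nat.dvd_prime (by norm_num)).1 hd with h | h
      · omega
      · exact h
    have : ∀ x : ZMod 7, x ^ 3 = 0 ∨ x ^ 3 = 1 ∨ x ^ 3 = -1 := by decide
    rcases this lam with h | h | h
    · have := congrArg (· ^ 2) h
      simp only [← pow_mul] at this
      rw [show 3 * 2 = orderOf lam by rw [hord], ← Units.val_pow_eq_pow_val,
        pow_orderOf_eq_one] at this
      exact absurd this (by decide)
    · exact h1 h
    · exact hneg h
  have gen : (lam : ZMod n) ^ 3 ≠ -1 → gammaGraph.IsGeneric lam := fun hneg =>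
    ⟨h2, h3, h7 hneg, hμ, hμ1, h1, hneg⟩
  refine ⟨⟨⟨(gammaSet n 3 lam).ncard, fun v => ?_⟩, gammaGraph.isEdgeTransitive hμ, ?_⟩, ?_⟩
  · rw [gammaGraph.encard_neighborSet, Set.Finite.cast_ncard_eq (Set.toFinite _)]
  · by_cases hneg : (lam : ZMod n) ^ 3 = -1
    · exact gammaGraph.not_isVertexTransitive_of_cube_eq_neg_one hμ h2 hμ1 hneg
    · intro hvt
      obtain ⟨g, hg⟩ := hvt (Sum.inl 1) (Sum.inr 1)
      have := gammaGraph.isLeft_apply (gen hneg) g (Sum.inl 1)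
      rw [hg] at this
      simp at this
  · intro hneg
    exact ⟨gammaGraph.isEdgeRegular (gen hneg),
      gammaGraph.isCyclic_and_card_stabilizer (gen hneg),
      gammaGraph.normal_range_transl (gen hneg),
      gammaGraph.isComplement'_stabilizer (gen hneg)⟩
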